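/- Let $X_1,X_2,\dots$ be independent random variables on a probability space, each with the Gaussian law $G=\mathcal N(m,\sigma^2)$, where $m\in\mathbb R$ and $\sigma>0$. Let $k\ge 2$ be an integer and let $f_p,g_p:\mathbb R\to\mathbb R$, $2\le p\le k$, be functions of class $C^1$. For $n\ge 1$ put $\overline X=\frac1n\sum_{i=1}^n X_i$ and $\mu_{n,\ell}=\frac1n\sum_{i=1}^n (X_i-\overline X)^\ell$, and $$b_{n,p}=\frac{\mu_{n,2p-1}}{\mu_{n,2}^{(2p-1)/2}},\qquad a_{n,p}=\frac{\mu_{n,2p}}{\mu_{n,2}^{p}},\qquad T_n(f,g,k)=\sum_{p=2}^k\bigl(f_p(b_{n,p})+g_p(a_{n,p})\bigr).$$ Let $m_\ell=\int x^\ell\,dG(x)$ and $\mu_\ell=\int (x-m)^\ell\,dG(x)$ be the non-centered and centered moments of $G$ (so $m_1=m$ and $\mu_2=\sigma^2$), let $h_\ell(x)=x^\ell$, and define the functions $$A(\ell)=h_\ell+\sum_{p=0}^{\ell-1}\binom{\ell}{p}(-1)^{\ell-p}\bigl(m_1^{\ell-p}h_p+(\ell-p)\,m_1^{\ell-p-1}m_p\,h_1\bigr),$$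 $$B(p)=\sigma^{-(2p-1)}\Bigl(A(2p-1)-\tfrac12(2p-1)\sigma^{-2}\mu_{2p-1}A(2)\Bigr),\qquad C(p)=\sigma^{-2p}\Bigl(A(2p)-p\,\sigma^{-2}\mu_{2p}A(2)\Bigr).$$ Finally let $$T_k=\sum_{p=2}^k\Bigl(f_p(0)+g_p\Bigl(\tfrac{(2p)!}{2^p\,p!}\Bigr)\Bigr),\qquad D_{k,0}=\sum_{p=2}^k\Bigl(f_p'(0)\,B(p)+g_p'\Bigl(\tfrac{(2p)!}{2^p\,p!}\Bigr)\,C(p)\Bigr).$$ Then $D_{k,0}$ and $D_{k,0}^2$ are $G$-integrable and, as $n\to\infty$, $$\sqrt n\,\bigl(T_n(f,g,k)-T_k\bigr)\longrightarrow\mathcal N(0,\sigma_{k,0}^2)\quad\text{in distribution},$$ where $$\sigma_{k,0}^2=\int D_{k,0}^2(x)\,dG(x)-\Bigl(\int D_{k,0}(x)\,dG(x)\Bigr)^2\ \ge 0$$ (if $\sigma_{k,0}^2=0$, the limit is the point mass at $0$). -/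

import Mathlib

open MeasureTheory ProbabilityTheory Filter Topology
open scoped NNReal Nat

namespace NormalityTest

noncomputable section

/-! Sample quantities. The sample of size `n` is `x 0, …, x (n - 1)`. -/

/-- The sample mean. -/
def sampleMean (n : ℕ) (x : ℕ → ℝ) : ℝ :=
  (1 / (n : ℝ)) * ∑ i ∈ Finset.range n, x i

/-- The centered empirical moment `μ_{n,ℓ}`. -/
def sampleCentralMoment (n ℓ : ℕ) (x : ℕ → ℝ) : ℝ :=
  (1 / (n : ℝ)) * ∑ i ∈ Finset.range n, (x i - sampleMean n x) ^ ℓ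

/-- `b_{n,p} = μ_{n,2p-1} / μ_{n,2}^{(2p-1)/2}`. -/
def bStat (n p : ℕ) (x : ℕ → ℝ) : ℝ :=
  sampleCentralMoment n (2 * p - 1) x /
    sampleCentralMoment n 2 x ^ ((2 * (p : ℝ) - 1) / 2)

/-- `a_{n,p} = μ_{n,2p} / μ_{n,2}^p`. -/
def aStat (n p : ℕ) (x : ℕ → ℝ) : ℝ :=
  sampleCentralMoment n (2 * p) x / sampleCentralMoment n 2 x ^ p

/-- The test statistic `T_n(f,g,k) = ∑_{p=2}^k (f_p(b_{n,p}) + g_p(a_{n,p}))`. -/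
def testStat (f g : ℕ → ℝ → ℝ) (k n : ℕ) (x : ℕ → ℝ) : ℝ :=
  ∑ p ∈ Finset.Icc 2 k, (f p (bStat n p x) + g p (aStat n p x))

/-! Population quantities, for the distribution `G` of the observations. -/

/-- The non-centered moment `m_ℓ`. -/
def popMoment (G : Measure ℝ) (ℓ : ℕ) : ℝ := moment id ℓ G

/-- The centered moment `μ_ℓ`. -/
def popCentralMoment (G : Measure ℝ) (ℓ : ℕ) : ℝ := centralMoment id ℓ G

/-- The standard deviation `σ`, with `σ ^ 2 = μ_2`. -/
def popSD (G : Measure ℝ) : ℝ := Real.sqrt (popCentralMoment G 2)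

/-- The function `A(ℓ) = h_ℓ + ∑_{p<ℓ} C_ℓ^p (-1)^{ℓ-p}
(m_1^{ℓ-p} h_p + (ℓ-p) m_1^{ℓ-p-1} m_p h_1)`, where `h_j(x) = x ^ j`. -/
def funA (G : Measure ℝ) (ℓ : ℕ) (x : ℝ) : ℝ :=
  x ^ ℓ + ∑ p ∈ Finset.range ℓ, (ℓ.choose p : ℝ) * (-1) ^ (ℓ - p) *
    (popMoment G 1 ^ (ℓ - p) * x ^ p +
      ((ℓ : ℝ) - (p : ℝ)) * popMoment G 1 ^ (ℓ - p - 1) * popMoment G p * x)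

/-- The function `B(p) = σ^{-(2p-1)} (A(2p-1) - (1/2)(2p-1) σ^{-2} μ_{2p-1} A(2))`. -/
def funB (G : Measure ℝ) (p : ℕ) (x : ℝ) : ℝ :=
  (popSD G ^ (2 * p - 1))⁻¹ *
    (funA G (2 * p - 1) x -
      (1 / 2) * (2 * (p : ℝ) - 1) * (popSD G ^ 2)⁻¹ * popCentralMoment G (2 * p - 1) * funA G 2 x)

/-- The function `C(p) = σ^{-2p} (A(2p) - p σ^{-2} μ_{2p} A(2))`. -/
def funC (G : Measure ℝ) (p : ℕ) (x : ℝ) : ℝ :=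
  (popSD G ^ (2 * p))⁻¹ *
    (funA G (2 * p) x -
      (p : ℝ) * (popSD G ^ 2)⁻¹ * popCentralMoment G (2 * p) * funA G 2 x)

/-! Gaussian centering and the function whose variance is the limiting variance. -/

/-- `(2p)! / (2^p p!)`. -/
def gaussianEven (p : ℕ) : ℝ := ((2 * p)! : ℝ) / (2 ^ p * (p ! : ℝ))

/-- `T_k = ∑_{p=2}^k (f_p(0) + g_p((2p)! / (2^p p!)))`. -/
def gaussianCenter (f g : ℕ → ℝ → ℝ) (k : ℕ) : ℝ :=
  ∑ p ∈ Finset.Icc 2 k, (f p 0 + g p (gaussianEven p))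

/-- `D_{k,0} = ∑_{p=2}^k (f_p'(0) B(p) + g_p'((2p)! / (2^p p!)) C(p))`. -/
def funD0 (G : Measure ℝ) (f g : ℕ → ℝ → ℝ) (k : ℕ) (x : ℝ) : ℝ :=
  ∑ p ∈ Finset.Icc 2 k,
    (deriv (f p) 0 * funB G p x + deriv (g p) (gaussianEven p) * funC G p x)

end

end NormalityTest

/-!
The test statistic is a smooth function of finitely many empirical moments, so it is asymptotically
linear: up to a term negligible in probability, `√n (T_n - T_k)` is a normalized centered sum
`n^{-1/2} ∑ (L(X_i) - ∫ L dG)` for a square integrable influence function `L`. The classical central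
limit theorem for the i.i.d. variables `L(X_i)` and Slutsky's theorem then give the Gaussian limit
of variance `Var_G(L)`, which may be zero (`IsAsymptoticallyLinear.tendstoInDistribution`).

Influence functions obey a calculus that makes a multivariate delta method unnecessary. They are
additive, and by the univariate delta method (`IsAsymptoticallyLinear.comp`) a map `F` differentiable
at the center `θ` multiplies them by `F' θ`; the remainder is a quantity tending to `0` in
probability times `√n (S_n - θ)`, which is bounded in probability by Chebyshev's inequality. The
product rule (`IsAsymptoticallyLinear.mul`) follows by polarization from the delta method for the
square. This calculus, applied to the binomial expansion of `μ_{n,ℓ}` in the empirical moments,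
yields the influence function `A(ℓ)`, then `B(p)` and `C(p)` for `b_{n,p}` and `a_{n,p}`, and
`D_{k,0}` for the test statistic. Only the centers use that the law is Gaussian: its odd central
moments vanish, and `μ_{2p} = σ^{2p} (2p)! / (2^p p!)`.
-/

/-! ### Stochastic order symbols -/

namespace NormalityTest

/-- `Y n = O_P(1)`: the real sequence `Y` is bounded in probability. Only large `n` matter, and no
measurability is required, since outer measure suffices. -/
def BoundedInProbability {Ω : Type*} [MeasurableSpace Ω] (P : Measure Ω) (Y : ℕ → Ω → ℝ) : Prop :=
  ∀ δ : ℝ, 0 < δ → ∃ M : ℝ, 0 < M ∧ ∀ᶠ n in atTop, P.real {ω | M ≤ |Y n ω|} < δ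

/-- `Y n = o_P(1)`: the real sequence `Y` tends to `0` in probability. -/
def NegligibleInProbability {Ω : Type*} [MeasurableSpace Ω] (P : Measure Ω)
    (Y : ℕ → Ω → ℝ) : Prop :=
  ∀ ε : ℝ, 0 < ε → ∀ δ : ℝ, 0 < δ → ∀ᶠ n in atTop, P.real {ω | ε ≤ |Y n ω|} < δ

section StochasticOrder

variable {Ω : Type*} [MeasurableSpace Ω] {P : Measure Ω} {Y Z : ℕ → Ω → ℝ}

lemma NegligibleInProbability.congr (h : NegligibleInProbability P Y)
    (hYZ : ∀ᶠ n in atTop, ∀ ω, Y n ω = Z n ω) : NegligibleInProbability P Z := by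
  intro ε hε δ hδ
  filter_upwards [h ε hε δ hδ, hYZ] with n hn hn'
  simpa only [hn'] using hn

lemma negligibleInProbability_of_tendsto {c : ℕ → ℝ} (hc : Tendsto c atTop (𝓝 0)) :
    NegligibleInProbability P (fun n (_ : Ω) => c n) := by
  intro ε hε δ hδ
  filter_upwards [Metric.tendsto_nhds.1 hc ε hε] with n hn
  rw [Real.dist_0_eq_abs] at hn
  simpa [not_le.2 hn] using hδ

lemma boundedInProbability_const (c : ℝ) : BoundedInProbability P (fun _ (_ : Ω) => c) := by
  intro δ hδ
  refine ⟨|c| + 1, by positivity, Eventually.of_forall fun n => ?_⟩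
  have : ¬ (|c| + 1 ≤ |c|) := by linarith
  simpa [this] using hδ

variable [IsProbabilityMeasure P]

lemma NegligibleInProbability.tendstoInMeasure (h : NegligibleInProbability P Y) :
    TendstoInMeasure P Y atTop 0 := by
  rw [tendstoInMeasure_iff_measureReal_norm]
  intro ε hε
  rw [Metric.tendsto_nhds]
  intro δ hδ
  filter_upwards [h ε hε δ hδ] with n hn
  simpa [abs_of_nonneg] using hn

/-- Union bound: an event contained in the union of two events of probability less than `δ / 2`
has probability less than `δ`. -/
lemma measureReal_lt_of_subset_union {s t u : Set Ω} {δ : ℝ} (hs : P.real s < δ / 2)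
    (ht : P.real t < δ / 2) (hu : u ⊆ s ∪ t) : P.real u < δ := by
  have h1 : P.real u ≤ P.real (s ∪ t) := measureReal_mono hu
  have h2 := measureReal_union_le (μ := P) s t
  linarith

lemma NegligibleInProbability.add (hY : NegligibleInProbability P Y)
    (hZ : NegligibleInProbability P Z) :
    NegligibleInProbability P (fun n ω => Y n ω + Z n ω) := by
  intro ε hε δ hδ
  filter_upwards [hY (ε / 2) (half_pos hε) (δ / 2) (half_pos hδ),
    hZ (ε / 2) (half_pos hε) (δ / 2) (half_pos hδ)] with n h1 h2
  refine measureReal_lt_of_subset_union h1 h2 fun ω hω => ?_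
  by_contra hc
  simp only [Set.mem_union, Set.mem_ofPred_eq, not_or, not_le] at hc hω
  linarith [abs_add_le (Y n ω) (Z n ω)]

lemma BoundedInProbability.add_negligible (hY : BoundedInProbability P Y)
    (hZ : NegligibleInProbability P Z) :
    BoundedInProbability P (fun n ω => Y n ω + Z n ω) := by
  intro δ hδ
  obtain ⟨M, hM, h1⟩ := hY (δ / 2) (half_pos hδ)
  refine ⟨M + 1, by linarith, ?_⟩
  filter_upwards [h1, hZ 1 one_pos (δ / 2) (half_pos hδ)] with n h1 h2
  refine measureReal_lt_of_subset_union h1 h2 fun ω hω => ?_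
  by_contra hc
  simp only [Set.mem_union, Set.mem_ofPred_eq, not_or, not_le] at hc hω
  linarith [abs_add_le (Y n ω) (Z n ω)]

lemma NegligibleInProbability.mul_bounded (hY : NegligibleInProbability P Y)
    (hZ : BoundedInProbability P Z) :
    NegligibleInProbability P (fun n ω => Y n ω * Z n ω) := by
  intro ε hε δ hδ
  obtain ⟨M, hM, h1⟩ := hZ (δ / 2) (half_pos hδ)
  filter_upwards [h1, hY (ε / M) (div_pos hε hM) (δ / 2) (half_pos hδ)] with n h1 h2
  refine measureReal_lt_of_subset_union h1 h2 fun ω hω => ?_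
  by_contra hc
  simp only [Set.mem_union, Set.mem_ofPred_eq, not_or, not_le, abs_mul] at hc hω
  have := mul_lt_mul'' hc.2 hc.1 (abs_nonneg _) (abs_nonneg _)
  rw [div_mul_cancel₀ _ hM.ne'] at this
  linarith

lemma NegligibleInProbability.const_mul (hY : NegligibleInProbability P Y) (c : ℝ) :
    NegligibleInProbability P (fun n ω => c * Y n ω) := by
  simpa only [mul_comm c] using hY.mul_bounded (boundedInProbability_const c)

/-- Continuous mapping at a constant limit; continuity is needed only at the limit. -/
lemma NegligibleInProbability.comp_continuousAt {θ : ℝ}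
    (hY : NegligibleInProbability P (fun n ω => Y n ω - θ)) {q : ℝ → ℝ}
    (hq : ContinuousAt q θ) : NegligibleInProbability P (fun n ω => q (Y n ω) - q θ) := by
  intro ε hε δ hδ
  obtain ⟨η, hη, h⟩ := Metric.continuousAt_iff.1 hq ε hε
  filter_upwards [hY η hη δ hδ] with n hn
  refine (measureReal_mono fun ω hω => ?_).trans_lt hn
  by_contra hc
  simp only [Set.mem_ofPred_eq, not_le] at hc hω
  exact absurd (h (x := Y n ω) hc) (not_lt.2 hω)

end StochasticOrder

/-! ### Asymptotically linear statistics and the delta method -/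

/-- The statistic `S` is asymptotically linear at `θ` with influence function `L`, for a sample `X`
from `G`: the function `L` is square integrable and
`√n (S_n - θ) = n^{-1/2} ∑_{i<n} (L(X_i) - ∫ L dG) + o_P(1)`.
The influence function is not required to be centered, so it is determined only up to an additive
constant. -/
structure IsAsymptoticallyLinear {Ω : Type*} [MeasurableSpace Ω] (P : Measure Ω) (X : ℕ → Ω → ℝ)
    (G : Measure ℝ) (S : ℕ → Ω → ℝ) (θ : ℝ) (L : ℝ → ℝ) : Prop where
  measurable : Measurable L
  memLp : MemLp L 2 G
  aemeasurable : ∀ n, AEMeasurable (S n) P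
  remainder : NegligibleInProbability P (fun n ω => √(n : ℝ) * (S n ω - θ) -
    (√(n : ℝ))⁻¹ * (∑ i ∈ Finset.range n, L (X i ω) - n * ∫ x, L x ∂G))

section AsymptoticLinearity

variable {Ω : Type*} [MeasurableSpace Ω] {P : Measure Ω}
  {X : ℕ → Ω → ℝ} {G : Measure ℝ} {S T : ℕ → Ω → ℝ} {θ τ : ℝ} {L K : ℝ → ℝ}

lemma memLp_comp (hlaw : ∀ i, HasLaw (X i) G P) (hm : Measurable L) (hL : MemLp L 2 G) (i : ℕ) :
    MemLp (fun ω => L (X i ω)) 2 P := by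
  have h := (hlaw i).map_eq ▸ hL
  exact (memLp_map_measure_iff hm.aestronglyMeasurable (hlaw i).aemeasurable).1 h

lemma integral_comp_eq (hlaw : ∀ i, HasLaw (X i) G P) (hm : Measurable L) (i : ℕ) :
    ∫ ω, L (X i ω) ∂P = ∫ x, L x ∂G := by
  rw [← (hlaw i).map_eq, integral_map (hlaw i).aemeasurable hm.aestronglyMeasurable]

lemma variance_comp_eq (hlaw : ∀ i, HasLaw (X i) G P) (hm : Measurable L) (i : ℕ) :
    Var[fun ω => L (X i ω); P] = Var[L; G] := by
  rw [← (hlaw i).map_eq, variance_map (by fun_prop) (hlaw i).aemeasurable]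
  rfl

variable [IsProbabilityMeasure P]

/-- Chebyshev: the normalized centered sums of i.i.d. square integrable variables have bounded
variance. -/
lemma boundedInProbability_normalized_sum (hlaw : ∀ i, HasLaw (X i) G P) (hindep : iIndepFun X P)
    (hm : Measurable L) (hL : MemLp L 2 G) :
    BoundedInProbability P (fun n ω =>
      (√(n : ℝ))⁻¹ * (∑ i ∈ Finset.range n, L (X i ω) - n * ∫ x, L x ∂G)) := by
  intro δ hδ
  set v := Var[L; G] with hv
  have hv0 : 0 ≤ v := variance_nonneg _ _
  set M := √((v + 1) / δ) with hM
  have hM0 : 0 < M := Real.sqrt_pos.2 (by positivity)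
  refine ⟨M, hM0, (eventually_gt_atTop 0).mono fun n hn => ?_⟩
  have hn' : (0 : ℝ) < n := by exact_mod_cast hn
  set W : Ω → ℝ := ∑ i ∈ Finset.range n, fun ω => L (X i ω) with hW
  have hWL : MemLp W 2 P := memLp_finsetSum' _ fun i _ => memLp_comp hlaw hm hL i
  have hmean : P[W] = n * ∫ x, L x ∂G := by
    simp only [hW, Finset.sum_apply]
    rw [integral_finsetSum _ fun i _ => (memLp_comp hlaw hm hL i).integrable one_le_two]
    simp [integral_comp_eq hlaw hm]
  have hvar : Var[W; P] = n * v := by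
    rw [hW, IndepFun.variance_sum (fun i _ => memLp_comp hlaw hm hL i)]
    · simp [variance_comp_eq hlaw hm, hv]
    · intro i _ j _ hij
      exact (hindep.indepFun hij).comp hm hm
  have hset : {ω | M ≤ |(√(n : ℝ))⁻¹ * (∑ i ∈ Finset.range n, L (X i ω) - n * ∫ x, L x ∂G)|}
      = {ω | √n * M ≤ |W ω - P[W]|} := by
    ext ω
    simp only [hmean, Set.mem_ofPred_eq, abs_mul, abs_inv,
      abs_of_nonneg (Real.sqrt_nonneg (n : ℝ))]
    rw [inv_mul_eq_div, le_div_iff₀ (Real.sqrt_pos.2 hn'), mul_comm, hW, Finset.sum_apply]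
  rw [hset]
  have hc := meas_ge_le_variance_div_sq hWL (c := √n * M) (mul_pos (Real.sqrt_pos.2 hn') hM0)
  have hle : P.real {ω | √n * M ≤ |W ω - P[W]|} ≤ Var[W; P] / (√n * M) ^ 2 := by
    rw [measureReal_def]
    refine ENNReal.toReal_le_of_le_ofReal (div_nonneg (variance_nonneg _ _) (sq_nonneg _)) hc
  refine hle.trans_lt ?_
  rw [hvar, mul_pow, Real.sq_sqrt hn'.le, hM, Real.sq_sqrt (by positivity),
    mul_div_mul_left _ _ hn'.ne', div_div_eq_mul_div, div_lt_iff₀ (by positivity)]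
  nlinarith

namespace IsAsymptoticallyLinear

lemma boundedInProbability (hlaw : ∀ i, HasLaw (X i) G P) (hindep : iIndepFun X P)
    (h : IsAsymptoticallyLinear P X G S θ L) :
    BoundedInProbability P (fun n ω => √(n : ℝ) * (S n ω - θ)) := by
  simpa only [add_sub_cancel] using
    (boundedInProbability_normalized_sum hlaw hindep h.measurable h.memLp).add_negligible
      h.remainder

lemma consistent (hlaw : ∀ i, HasLaw (X i) G P) (hindep : iIndepFun X P)
    (h : IsAsymptoticallyLinear P X G S θ L) :
    NegligibleInProbability P (fun n ω => S n ω - θ) := by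
  have hs : Tendsto (fun n : ℕ => (√(n : ℝ))⁻¹) atTop (𝓝 0) :=
    tendsto_inv_atTop_zero.comp (Real.tendsto_sqrt_atTop.comp tendsto_natCast_atTop_atTop)
  refine ((negligibleInProbability_of_tendsto hs).mul_bounded
    (h.boundedInProbability hlaw hindep)).congr ?_
  filter_upwards [eventually_gt_atTop 0] with n hn ω
  have : √(n : ℝ) ≠ 0 := (Real.sqrt_pos.2 (by exact_mod_cast hn)).ne'
  field_simp

lemma const (P : Measure Ω) [IsProbabilityMeasure P] (X : ℕ → Ω → ℝ) (G : Measure ℝ) (c : ℝ) :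
    IsAsymptoticallyLinear P X G (fun _ _ => c) c (fun _ => 0) where
  measurable := measurable_const
  memLp := MemLp.zero'
  aemeasurable _ := aemeasurable_const
  remainder := by
    simpa using negligibleInProbability_of_tendsto (P := P) (tendsto_const_nhds (x := (0 : ℝ)))

lemma add [IsFiniteMeasure G] (hS : IsAsymptoticallyLinear P X G S θ L)
    (hT : IsAsymptoticallyLinear P X G T τ K) :
    IsAsymptoticallyLinear P X G (fun n ω => S n ω + T n ω) (θ + τ) (fun x => L x + K x) where
  measurable := hS.measurable.add hT.measurable
  memLp := hS.memLp.add hT.memLp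
  aemeasurable n := (hS.aemeasurable n).add (hT.aemeasurable n)
  remainder := by
    refine (hS.remainder.add hT.remainder).congr (Eventually.of_forall fun n ω => ?_)
    rw [integral_add (hS.memLp.integrable one_le_two) (hT.memLp.integrable one_le_two),
      Finset.sum_add_distrib]
    ring

lemma const_mul (hS : IsAsymptoticallyLinear P X G S θ L) (c : ℝ) :
    IsAsymptoticallyLinear P X G (fun n ω => c * S n ω) (c * θ) (fun x => c * L x) where
  measurable := hS.measurable.const_mul c
  memLp := hS.memLp.const_mul c
  aemeasurable n := (hS.aemeasurable n).const_mul c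
  remainder := by
    refine (hS.remainder.const_mul c).congr (Eventually.of_forall fun n ω => ?_)
    rw [integral_const_mul, ← Finset.mul_sum]
    ring

lemma sum [IsFiniteMeasure G] {ι : Type*} (s : Finset ι) {S : ι → ℕ → Ω → ℝ} {θ : ι → ℝ}
    {L : ι → ℝ → ℝ} (h : ∀ j ∈ s, IsAsymptoticallyLinear P X G (S j) (θ j) (L j)) :
    IsAsymptoticallyLinear P X G (fun n ω => ∑ j ∈ s, S j n ω) (∑ j ∈ s, θ j)
      (fun x => ∑ j ∈ s, L j x) := by
  classical
  induction s using Finset.induction_on with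
  | empty => simpa using const P X G 0
  | insert a s ha ih =>
    simp only [Finset.sum_insert ha]
    exact (h a (Finset.mem_insert_self a s)).add
      (ih fun j hj => h j (Finset.mem_insert_of_mem hj))

/-- The **delta method**: a transformation differentiable at the center multiplies the influence
function by the derivative. -/
lemma comp (hlaw : ∀ i, HasLaw (X i) G P) (hindep : iIndepFun X P)
    (hS : IsAsymptoticallyLinear P X G S θ L) {F : ℝ → ℝ} {F' : ℝ} (hF : Measurable F)
    (hderiv : HasDerivAt F F' θ) :
    IsAsymptoticallyLinear P X G (fun n ω => F (S n ω)) (F θ) (fun x => F' * L x) where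
  measurable := hS.measurable.const_mul F'
  memLp := hS.memLp.const_mul F'
  aemeasurable n := hF.comp_aemeasurable (hS.aemeasurable n)
  remainder := by
    have hlin := (hS.const_mul F').remainder
    -- the divided difference `dslope F θ` is continuous at `θ`, with value `F'`
    have hq : ContinuousAt (dslope F θ) θ := continuousAt_dslope_same.2 hderiv.differentiableAt
    have hrem := ((hS.consistent hlaw hindep).comp_continuousAt hq).mul_bounded
      (hS.boundedInProbability hlaw hindep)
    refine (hrem.add hlin).congr (Eventually.of_forall fun n ω => ?_)
    have hs := sub_smul_dslope F θ (S n ω)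
    rw [smul_eq_mul] at hs
    rw [dslope_same, hderiv.deriv, ← hs]
    ring

/-- Product rule for influence functions, by polarization from the delta method for the square. -/
lemma mul [IsFiniteMeasure G] (hlaw : ∀ i, HasLaw (X i) G P) (hindep : iIndepFun X P)
    (hS : IsAsymptoticallyLinear P X G S θ L) (hT : IsAsymptoticallyLinear P X G T τ K) :
    IsAsymptoticallyLinear P X G (fun n ω => S n ω * T n ω) (θ * τ)
      (fun x => τ * L x + θ * K x) := by
  have hsq (t : ℝ) : HasDerivAt (fun s : ℝ => s ^ 2) (2 * t) t := by
    simpa using hasDerivAt_pow 2 t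
  have h1 := (hS.add hT).comp hlaw hindep (by fun_prop) (hsq _)
  have h2 := (hS.add (hT.const_mul (-1))).comp hlaw hindep (by fun_prop) (hsq _)
  convert (h1.const_mul (1 / 4)).add (h2.const_mul (-(1 / 4))) using 1
  · ext; ring
  · ring
  · ext; ring

/-- The central limit theorem for asymptotically linear statistics. -/
lemma tendstoInDistribution (hlaw : ∀ i, HasLaw (X i) G P) (hindep : iIndepFun X P)
    (hS : IsAsymptoticallyLinear P X G S θ L) :
    TendstoInDistribution (fun (n : ℕ) ω => √(n : ℝ) * (S n ω - θ)) atTop (id : ℝ → ℝ)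
      (fun _ => P) (gaussianReal 0 Var[L; G].toNNReal) := by
  have hclt := tendstoInDistribution_inv_sqrt_mul_sum_sub (X := fun i ω => L (X i ω)) (P := P)
    (Y := (id : ℝ → ℝ)) (P' := gaussianReal 0 Var[L; G].toNNReal)
    ⟨aemeasurable_id, by rw [Measure.map_id, variance_comp_eq hlaw hS.measurable]⟩
    (memLp_comp hlaw hS.measurable hS.memLp 0) (hindep.comp (fun _ => L) fun _ => hS.measurable)
    (fun i => IdentDistrib.comp (u := L)
      ⟨(hlaw i).aemeasurable, (hlaw 0).aemeasurable, by rw [(hlaw i).map_eq, (hlaw 0).map_eq]⟩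
      hS.measurable)
  simp only [integral_comp_eq hlaw hS.measurable] at hclt
  refine tendstoInDistribution_of_tendstoInMeasure_sub _ _ hclt ?_ fun n =>
    ((hS.aemeasurable n).sub_const θ).const_mul _
  exact hS.remainder.tendstoInMeasure

end IsAsymptoticallyLinear

end AsymptoticLinearity

/-! ### Empirical moments -/

section Moments

/-- Binomial expansion around `c`, with the leading term split off. -/
lemma sub_pow_eq_add_sum (x c : ℝ) (ℓ : ℕ) :
    (x - c) ^ ℓ = x ^ ℓ + ∑ p ∈ Finset.range ℓ,
      (ℓ.choose p : ℝ) * (-1) ^ (ℓ - p) * (c ^ (ℓ - p) * x ^ p) := by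
  rw [sub_eq_add_neg, add_pow, Finset.sum_range_succ, add_comm]
  congr 1
  · simp
  · refine Finset.sum_congr rfl fun p _ => ?_
    rw [neg_pow]
    ring

lemma sampleCentralMoment_eq (n ℓ : ℕ) (x : ℕ → ℝ) :
    sampleCentralMoment n ℓ x = (1 / (n : ℝ)) * ∑ i ∈ Finset.range n, x i ^ ℓ +
      ∑ p ∈ Finset.range ℓ, (ℓ.choose p : ℝ) * (-1) ^ (ℓ - p) *
        (sampleMean n x ^ (ℓ - p) * ((1 / (n : ℝ)) * ∑ i ∈ Finset.range n, x i ^ p)) := by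
  unfold sampleCentralMoment
  simp_rw [sub_pow_eq_add_sum, Finset.sum_add_distrib, mul_add]
  congr 1
  rw [Finset.sum_comm, Finset.mul_sum]
  refine Finset.sum_congr rfl fun p _ => ?_
  rw [← Finset.mul_sum, ← Finset.mul_sum]
  ring

variable {G : Measure ℝ}

lemma popSD_sq (hv : 0 < popCentralMoment G 2) : popSD G ^ 2 = popCentralMoment G 2 :=
  Real.sq_sqrt hv.le

lemma popCentralMoment_eq [IsProbabilityMeasure G] (hG : ∀ ℓ : ℕ, MemLp (fun x : ℝ => x ^ ℓ) 2 G)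
    (ℓ : ℕ) : popCentralMoment G ℓ = popMoment G ℓ +
      ∑ p ∈ Finset.range ℓ, (ℓ.choose p : ℝ) * (-1) ^ (ℓ - p) *
        (popMoment G 1 ^ (ℓ - p) * popMoment G p) := by
  have hint (j : ℕ) : Integrable (fun x : ℝ => x ^ j) G := (hG j).integrable one_le_two
  have h1 : popCentralMoment G ℓ = ∫ x, (x - popMoment G 1) ^ ℓ ∂G := by
    simp [popCentralMoment, centralMoment, popMoment, moment]
  rw [h1]
  simp_rw [sub_pow_eq_add_sum]
  rw [integral_add (hint ℓ) (integrable_finsetSum _ fun p _ => ((hint p).const_mul _).const_mul _),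
    integral_finsetSum _ fun p _ => ((hint p).const_mul _).const_mul _]
  simp only [integral_const_mul]
  rfl

variable {Ω : Type*} [MeasurableSpace Ω] {P : Measure Ω} {X : ℕ → Ω → ℝ}

lemma isAsymptoticallyLinear_average [IsProbabilityMeasure P] (hlaw : ∀ i, HasLaw (X i) G P)
    {h : ℝ → ℝ} (hm : Measurable h) (hL : MemLp h 2 G) :
    IsAsymptoticallyLinear P X G
      (fun n ω => (1 / (n : ℝ)) * ∑ i ∈ Finset.range n, h (X i ω)) (∫ x, h x ∂G) h where
  measurable := hm
  memLp := hL
  aemeasurable n := (Finset.aemeasurable_fun_sum _ fun i _ =>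
    hm.comp_aemeasurable (hlaw i).aemeasurable).const_mul _
  remainder := by
    refine (negligibleInProbability_of_tendsto (P := P) (tendsto_const_nhds (x := (0 : ℝ)))).congr
      ((eventually_gt_atTop 0).mono fun n hn ω => ?_)
    have hn' : (0 : ℝ) < n := by exact_mod_cast hn
    have hs : √(n : ℝ) ≠ 0 := (Real.sqrt_pos.2 hn').ne'
    field_simp
    rw [Real.sq_sqrt hn'.le]
    ring

variable [IsProbabilityMeasure G] [IsProbabilityMeasure P]

/-- The influence function of the empirical central moment `μ_{n,ℓ}` is `A(ℓ)`. -/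
lemma isAsymptoticallyLinear_sampleCentralMoment (hlaw : ∀ i, HasLaw (X i) G P)
    (hindep : iIndepFun X P) (hG : ∀ ℓ : ℕ, MemLp (fun x : ℝ => x ^ ℓ) 2 G) (ℓ : ℕ) :
    IsAsymptoticallyLinear P X G (fun n ω => sampleCentralMoment n ℓ (fun i => X i ω))
      (popCentralMoment G ℓ) (funA G ℓ) := by
  have havg (j : ℕ) : IsAsymptoticallyLinear P X G
      (fun n ω => (1 / (n : ℝ)) * ∑ i ∈ Finset.range n, X i ω ^ j) (popMoment G j)
      (fun x => x ^ j) :=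
    isAsymptoticallyLinear_average hlaw (h := fun x => x ^ j) (by fun_prop) (hG j)
  have hmean : IsAsymptoticallyLinear P X G (fun n ω => sampleMean n (fun i => X i ω))
      (popMoment G 1) (fun x => x) := by
    simpa only [pow_one, sampleMean] using havg 1
  have h := (havg ℓ).add (IsAsymptoticallyLinear.sum (Finset.range ℓ) fun p _ =>
    ((hmean.comp hlaw hindep (F := fun t => t ^ (ℓ - p)) (by fun_prop)
      (hasDerivAt_pow (ℓ - p) _)).mul hlaw hindep (havg p)).const_mul
        ((ℓ.choose p : ℝ) * (-1) ^ (ℓ - p)))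
  rw [popCentralMoment_eq hG]
  convert h using 1
  · ext n ω
    exact sampleCentralMoment_eq n ℓ _
  · ext x
    unfold funA
    congr 1
    refine Finset.sum_congr rfl fun p hp => ?_
    rw [Nat.cast_sub (Finset.mem_range.1 hp).le]
    ring

/-- The influence function of `b_{n,p}` is `B(p)`. The exponent `(2p-1)/2` is a half-integer, so the
delta method is applied to the real power `t ↦ t ^ ((2p-1)/2)`, which is differentiable at
`μ_2 > 0`; samples of zero variance, where the ratio takes a junk value, play no role. -/
lemma isAsymptoticallyLinear_bStat (hlaw : ∀ i, HasLaw (X i) G P) (hindep : iIndepFun X P)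
    (hG : ∀ ℓ : ℕ, MemLp (fun x : ℝ => x ^ ℓ) 2 G) (hv : 0 < popCentralMoment G 2)
    {p : ℕ} (hp : 1 ≤ p) :
    IsAsymptoticallyLinear P X G (fun n ω => bStat n p (fun i => X i ω))
      (popCentralMoment G (2 * p - 1) * (popSD G ^ (2 * p - 1))⁻¹) (funB G p) := by
  set v := popCentralMoment G 2 with hvdef
  set c : ℝ := (2 * (p : ℝ) - 1) / 2 with hc
  have hpow : v ^ c = popSD G ^ (2 * p - 1) := by
    rw [popSD, Real.sqrt_eq_rpow, ← Real.rpow_natCast, ← Real.rpow_mul hv.le]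
    congr 1
    rw [Nat.cast_sub (by lia), hc]
    push_cast
    ring
  have hs : v ^ c ≠ 0 := (Real.rpow_pos_of_pos hv c).ne'
  have hd := (Real.hasDerivAt_rpow_const (p := c) (Or.inl hv.ne')).fun_inv hs
  have h := (isAsymptoticallyLinear_sampleCentralMoment hlaw hindep hG (2 * p - 1)).mul hlaw hindep
    ((isAsymptoticallyLinear_sampleCentralMoment hlaw hindep hG 2).comp hlaw hindep
      (F := fun t => (t ^ c)⁻¹) (by fun_prop) hd)
  convert h using 1
  · ext n ω
    exact div_eq_mul_inv _ _
  · rw [← hpow]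
  · ext x
    rw [funB, popSD_sq hv, ← hvdef, ← hpow, Real.rpow_sub_one hv.ne', hc]
    field_simp
    ring

/-- The influence function of `a_{n,p}` is `C(p)`. -/
lemma isAsymptoticallyLinear_aStat (hlaw : ∀ i, HasLaw (X i) G P) (hindep : iIndepFun X P)
    (hG : ∀ ℓ : ℕ, MemLp (fun x : ℝ => x ^ ℓ) 2 G) (hv : 0 < popCentralMoment G 2)
    {p : ℕ} (hp : 1 ≤ p) :
    IsAsymptoticallyLinear P X G (fun n ω => aStat n p (fun i => X i ω))
      (popCentralMoment G (2 * p) * (popSD G ^ (2 * p))⁻¹) (funC G p) := by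
  set v := popCentralMoment G 2 with hvdef
  have hpow : v ^ p = popSD G ^ (2 * p) := by rw [pow_mul, popSD_sq hv]
  have hs : v ^ p ≠ 0 := (pow_pos hv p).ne'
  have h := (isAsymptoticallyLinear_sampleCentralMoment hlaw hindep hG (2 * p)).mul hlaw hindep
    ((isAsymptoticallyLinear_sampleCentralMoment hlaw hindep hG 2).comp hlaw hindep
      (F := fun t => (t ^ p)⁻¹) (by fun_prop) ((hasDerivAt_pow p v).fun_inv hs))
  convert h using 1
  · ext n ω
    exact div_eq_mul_inv _ _
  · rw [← hpow]
  · ext x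
    obtain ⟨r, rfl⟩ : ∃ r, p = r + 1 := ⟨p - 1, by lia⟩
    rw [funC, popSD_sq hv, ← hvdef, ← hpow, Nat.add_sub_cancel]
    field_simp
    ring

end Moments

/-! ### Central moments of the Gaussian law -/

section Gaussian

lemma integral_pow_odd_gaussianReal {j : ℕ} (hj : Odd j) (v : ℝ≥0) :
    ∫ x, x ^ j ∂gaussianReal 0 v = 0 := by
  have h : ∫ x, x ^ j ∂gaussianReal 0 v = ∫ x, (-x) ^ j ∂gaussianReal 0 v := by
    conv_lhs => rw [← neg_zero, ← gaussianReal_map_neg]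
    rw [integral_map (by fun_prop) (by fun_prop)]
  simp only [hj.neg_pow, integral_neg] at h
  linarith

lemma doubleFactorial_two_mul_sub_one (p : ℕ) :
    ((2 * p - 1).doubleFactorial : ℝ) = gaussianEven p := by
  rw [gaussianEven, eq_div_iff (by positivity)]
  cases p with
  | zero => simp
  | succ r =>
    have h := Nat.factorial_eq_mul_doubleFactorial (2 * r + 1)
    rw [show 2 * r + 1 + 1 = 2 * (r + 1) by ring, Nat.doubleFactorial_two_mul] at h
    rw [show 2 * (r + 1) - 1 = 2 * r + 1 by lia, h]
    push_cast
    ring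

/-- Even moments of the standard Gaussian law, from the values of the Gamma function at
half-integers. -/
lemma integral_pow_even_gaussianReal (p : ℕ) :
    ∫ x, x ^ (2 * p) ∂gaussianReal 0 1 = gaussianEven p := by
  rw [integral_gaussianReal_eq_integral_smul one_ne_zero]
  have h1 (x : ℝ) : gaussianPDFReal 0 1 x • x ^ (2 * p) = (√(2 * Real.pi))⁻¹ *
      (|x| ^ (2 * (p : ℝ)) * Real.exp (-(1 / 2) * |x| ^ (2 : ℝ))) := by
    have h2 : |x| ^ (2 : ℝ) = x ^ 2 := by rw [Real.rpow_two, sq_abs]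
    have h3 : |x| ^ (2 * (p : ℝ)) = x ^ (2 * p) := by
      rw [Real.rpow_mul (abs_nonneg x), h2, Real.rpow_natCast, pow_mul]
    rw [h2, h3, gaussianPDFReal, smul_eq_mul, sub_zero, NNReal.coe_one]
    ring_nf
  simp_rw [h1]
  rw [integral_const_mul, integral_comp_abs
    (f := fun x => x ^ (2 * (p : ℝ)) * Real.exp (-(1 / 2) * x ^ (2 : ℝ))),
    integral_rpow_mul_exp_neg_mul_rpow two_pos (by linarith [Nat.cast_nonneg (α := ℝ) p])
      (by norm_num), show (2 * (p : ℝ) + 1) / 2 = p + 1 / 2 by ring, Real.Gamma_nat_add_half,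
    doubleFactorial_two_mul_sub_one, show -(2 * (p : ℝ) + 1) / 2 = -(p + 1 / 2) by ring, one_div,
    Real.inv_rpow two_pos.le, ← Real.rpow_neg two_pos.le, neg_neg, Real.rpow_add two_pos,
    Real.rpow_natCast, ← one_div 2, ← Real.sqrt_eq_rpow, Real.sqrt_mul two_pos.le]
  field_simp

lemma popCentralMoment_gaussianReal (m : ℝ) (σ : ℝ≥0) (ℓ : ℕ) :
    popCentralMoment (gaussianReal m (σ ^ 2)) ℓ = σ ^ ℓ * ∫ x, x ^ ℓ ∂gaussianReal 0 1 := by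
  have hmap : gaussianReal m (σ ^ 2) = (gaussianReal 0 1).map (fun x => σ * x + m) := by
    have h1 := gaussianReal_map_const_mul (μ := 0) (v := 1) (σ : ℝ)
    have h2 := gaussianReal_map_add_const (μ := 0) (v := σ ^ 2) m
    have h3 : NNReal.mk ((σ : ℝ) ^ 2) (sq_nonneg _) = σ ^ 2 := NNReal.eq (by simp)
    rw [mul_zero, mul_one, h3] at h1
    rw [zero_add, ← h1, Measure.map_map (by fun_prop) (by fun_prop)] at h2
    exact h2.symm
  have h : popCentralMoment (gaussianReal m (σ ^ 2)) ℓ =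
      ∫ x, (x - m) ^ ℓ ∂gaussianReal m (σ ^ 2) := by
    simp [popCentralMoment, centralMoment, integral_id_gaussianReal]
  rw [h, hmap, integral_map (by fun_prop) (by fun_prop)]
  simp only [add_sub_cancel_right, mul_pow, integral_const_mul]

lemma popCentralMoment_two_gaussianReal (m : ℝ) (σ : ℝ≥0) :
    popCentralMoment (gaussianReal m (σ ^ 2)) 2 = σ ^ 2 := by
  have h := integral_pow_even_gaussianReal 1
  norm_num [gaussianEven] at h
  rw [popCentralMoment_gaussianReal, h, mul_one]

lemma popSD_gaussianReal (m : ℝ) (σ : ℝ≥0) : popSD (gaussianReal m (σ ^ 2)) = σ := by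
  rw [popSD, popCentralMoment_two_gaussianReal, Real.sqrt_sq σ.coe_nonneg]

lemma memLp_pow_gaussianReal (m : ℝ) (v : ℝ≥0) (ℓ : ℕ) :
    MemLp (fun x : ℝ => x ^ ℓ) 2 (gaussianReal m v) := by
  refine (memLp_two_iff_integrable_sq (by fun_prop)).2 ?_
  have h := (memLp_id_gaussianReal' (μ := m) (v := v) (2 * ℓ : ℕ)
    (ENNReal.natCast_ne_top _)).integrable_norm_pow'
  simpa only [id, Real.norm_eq_abs, pow_mul, sq_abs, pow_right_comm] using h

end Gaussian

/-! ### The limit law of the test statistic -/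

/-- For Gaussian observations `b_{n,p}` is centered at `0` and `a_{n,p}` at `(2p)! / (2^p p!)`, so
`T_n(f,g,k)` has center `T_k` and influence function `D_{k,0}`. -/
lemma isAsymptoticallyLinear_testStat {Ω : Type*} [MeasurableSpace Ω] {P : Measure Ω}
    [IsProbabilityMeasure P] {X : ℕ → Ω → ℝ} {m : ℝ} {σ : ℝ≥0} (hσ : 0 < σ)
    (hlaw : ∀ i, HasLaw (X i) (gaussianReal m (σ ^ 2)) P) (hindep : iIndepFun X P)
    {f g : ℕ → ℝ → ℝ} {k : ℕ} (hf : ∀ p ∈ Finset.Icc 2 k, ContDiff ℝ 1 (f p))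
    (hg : ∀ p ∈ Finset.Icc 2 k, ContDiff ℝ 1 (g p)) :
    IsAsymptoticallyLinear P X (gaussianReal m (σ ^ 2))
      (fun n ω => testStat f g k n (fun i => X i ω)) (gaussianCenter f g k)
      (funD0 (gaussianReal m (σ ^ 2)) f g k) := by
  have hG := memLp_pow_gaussianReal m (σ ^ 2)
  have hv : 0 < popCentralMoment (gaussianReal m (σ ^ 2)) 2 := by
    rw [popCentralMoment_two_gaussianReal]
    positivity
  refine IsAsymptoticallyLinear.sum (Finset.Icc 2 k) fun p hp => ?_
  have hp1 : 1 ≤ p := one_le_two.trans (Finset.mem_Icc.1 hp).1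
  have hb := isAsymptoticallyLinear_bStat hlaw hindep hG hv hp1
  have ha := isAsymptoticallyLinear_aStat hlaw hindep hG hv hp1
  rw [popCentralMoment_gaussianReal, integral_pow_odd_gaussianReal ⟨p - 1, by lia⟩, mul_zero,
    zero_mul] at hb
  rw [popCentralMoment_gaussianReal, integral_pow_even_gaussianReal, popSD_gaussianReal,
    mul_comm, inv_mul_cancel_left₀ (by positivity)] at ha
  exact (hb.comp hlaw hindep (hf p hp).continuous.measurable
      ((hf p hp).differentiable one_ne_zero _).hasDerivAt).add
    (ha.comp hlaw hindep (hg p hp).continuous.measurable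
      ((hg p hp).differentiable one_ne_zero _).hasDerivAt)

end NormalityTest

theorem corollary1 {Ω : Type*} [MeasurableSpace Ω] (P : Measure Ω) [IsProbabilityMeasure P]
    (X : ℕ → Ω → ℝ) (m : ℝ) (σ : ℝ≥0) (hσ : 0 < σ)
    (hlaw : ∀ i, HasLaw (X i) (gaussianReal m (σ ^ 2)) P)
    (hindep : iIndepFun X P)
    (f g : ℕ → ℝ → ℝ) (k : ℕ) (hk : 2 ≤ k)
    (hf : ∀ p ∈ Finset.Icc 2 k, ContDiff ℝ 1 (f p))
    (hg : ∀ p ∈ Finset.Icc 2 k, ContDiff ℝ 1 (g p)) :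
    Integrable (NormalityTest.funD0 (gaussianReal m (σ ^ 2)) f g k) (gaussianReal m (σ ^ 2)) ∧
    Integrable (fun x => NormalityTest.funD0 (gaussianReal m (σ ^ 2)) f g k x ^ 2)
      (gaussianReal m (σ ^ 2)) ∧
    ∃ v : ℝ≥0,
      (v : ℝ) = (∫ x, NormalityTest.funD0 (gaussianReal m (σ ^ 2)) f g k x ^ 2
            ∂(gaussianReal m (σ ^ 2))) -
          (∫ x, NormalityTest.funD0 (gaussianReal m (σ ^ 2)) f g k x
            ∂(gaussianReal m (σ ^ 2))) ^ 2 ∧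
      TendstoInDistribution
        (fun (n : ℕ) (ω : Ω) => Real.sqrt (n : ℝ) *
          (NormalityTest.testStat f g k n (fun i => X i ω) -
            NormalityTest.gaussianCenter f g k))
        atTop (id : ℝ → ℝ) (fun _ => P) (gaussianReal 0 v) := by
  have h := NormalityTest.isAsymptoticallyLinear_testStat hσ hlaw hindep hf hg
  refine ⟨h.memLp.integrable one_le_two, h.memLp.integrable_sq, _, ?_,
    h.tendstoInDistribution hlaw hindep⟩
  rw [Real.coe_toNNReal _ (variance_nonneg _ _), variance_eq_sub h.memLp]
  rfl
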